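/- Let $K$ be a field, let $S=K[x_1,\dots,x_n]$ be the polynomial ring with its $\mathbb{Z}^n$-grading, and for a monomial ideal $I\subset S$ and $i\ge 0$ let $$\mathrm{HS}_i(I)=\bigl(\mathbf{x}^{\mathbf a}:\ \mathbf a\in\mathbb{Z}_{\ge0}^n,\ \mathrm{Tor}_i^S(K,I)_{\mathbf a}\neq 0\bigr)$$ be the $i$th homological shift ideal of $I$. Let $I\subset S$ be a polymatroidal ideal, that is, a monomial ideal such that the exponent vectors of its minimal monomial generators form the set of bases of a discrete polymatroid. Then $I$ satisfies the $1$st homological strong persistence property, i.e. $$\mathrm{HS}_1(I^{k+1}):I=\mathrm{HS}_1(I^k)\qquad\text{for all } k\ge 1.$$ In particular, $$\mathrm{Ass}\,\mathrm{HS}_1(I)\subseteq\mathrm{Ass}\,\mathrm{HS}_1(I^2)\subseteq\mathrm{Ass}\,\mathrm{HS}_1(I^3)\subseteq\cdots,$$ where $\mathrm{Ass}\,J$ denotes the set of associated primes of the $S$-module $S/J$. -/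

import Mathlib

open MvPolynomial

namespace HomShift

/-! ### Discrete polymatroids and polymatroidal ideals -/

/-- A discrete polymatroid on the ground set `Fin n`: a nonempty finite set `P` of vectors in
`ℕⁿ` which is closed under passing to smaller vectors and such that for `u, v ∈ P` with
`|u| < |v|` there is an `i` with `u i < v i` and `u + eᵢ ∈ P`. -/
structure IsDiscretePolymatroid {n : ℕ} (P : Set (Fin n →₀ ℕ)) : Prop where
  nonempty : P.Nonempty
  finite : P.Finite
  mem_of_le : ∀ u ∈ P, ∀ v : Fin n →₀ ℕ, v ≤ u → v ∈ P
  augmentation : ∀ u ∈ P, ∀ v ∈ P, u.degree < v.degree →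
    ∃ i, u i < v i ∧ u + Finsupp.single i 1 ∈ P

/-- The bases of a discrete polymatroid: its maximal vectors for the componentwise order. -/
def polymatroidBases {n : ℕ} (P : Set (Fin n →₀ ℕ)) : Set (Fin n →₀ ℕ) :=
  {u | Maximal (fun v => v ∈ P) u}

section Ideals

variable {K : Type*} [Field K] {n : ℕ}

/-- A monomial ideal: an ideal generated by monomials. -/
def IsMonomialIdeal (I : Ideal (MvPolynomial (Fin n) K)) : Prop :=
  ∃ s : Set (Fin n →₀ ℕ), I = Ideal.span ((fun a => monomial a (1 : K)) '' s)

/-- The exponent vectors of the minimal monomial generators `𝒢(I)` of a monomial ideal `I`: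
the minimal `a` with `x^a ∈ I`. -/
def minimalGenerators (I : Ideal (MvPolynomial (Fin n) K)) : Set (Fin n →₀ ℕ) :=
  {a | Minimal (fun b => monomial b (1 : K) ∈ I) a}

/-- A polymatroidal ideal: a monomial ideal such that the exponent vectors of its minimal
monomial generators are the bases of a discrete polymatroid. -/
def IsPolymatroidal (I : Ideal (MvPolynomial (Fin n) K)) : Prop :=
  IsMonomialIdeal I ∧
    ∃ P : Set (Fin n →₀ ℕ), IsDiscretePolymatroid P ∧ minimalGenerators I = polymatroidBases P

end Ideals

/-! ### Multigraded Tor and homological shift ideals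

Write `S = K[x₁, …, xₙ]`. The Koszul complex on `x₁, …, xₙ` is the (minimal) `ℤⁿ`-graded free
resolution of `K = S / (x₁, …, xₙ)`: in homological degree `i` it has a basis `e_F`, where `F`
runs over the subsets of `{1, …, n}` with `i` elements, `e_F` has multidegree `∑ j ∈ F, e_j`, and
`d e_F = ∑ j ∈ F, (-1)^{#{l ∈ F | l < j}} x_j e_{F ∖ j}`. So `Tor_i^S(K, I)` is the homology at
position `i` of the complex obtained by tensoring it with `I`, and `Tor_i^S(K, I)_a` is the part of
multidegree `a`. -/

section Koszul

variable {K : Type*} [Field K] {n : ℕ}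

/-- The Koszul differential. A family `f : Finset (Fin n) → S` stands for `∑ F, f F • e_F`; the
coefficient of `e_G` in `d (∑ F, f F • e_F)` collects the contributions of `F = G ∪ {j}` with
`j ∉ G`. -/
noncomputable def koszulD (K : Type*) [Field K] (n : ℕ) :
    (Finset (Fin n) → MvPolynomial (Fin n) K) →ₗ[MvPolynomial (Fin n) K]
      (Finset (Fin n) → MvPolynomial (Fin n) K) :=
  LinearMap.pi fun G => ∑ j ∈ Gᶜ,
    ((-1) ^ (G.filter (· < j)).card * X j : MvPolynomial (Fin n) K) •
      LinearMap.proj (R := MvPolynomial (Fin n) K)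
        (φ := fun _ : Finset (Fin n) => MvPolynomial (Fin n) K) (insert j G)

theorem koszulD_apply (f : Finset (Fin n) → MvPolynomial (Fin n) K) (G : Finset (Fin n)) :
    koszulD K n f G = ∑ j ∈ Gᶜ, (-1) ^ (G.filter (· < j)).card * X j * f (insert j G) := by
  simp [koszulD]

theorem koszulD_koszulD (f : Finset (Fin n) → MvPolynomial (Fin n) K) :
    koszulD K n (koszulD K n f) = 0 := by
  ext1 G
  rw [koszulD_apply]
  simp_rw [koszulD_apply, Finset.mul_sum]
  rw [Finset.sum_sigma', Pi.zero_apply]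
  refine Finset.sum_involution (fun p _ => ⟨p.2, p.1⟩) ?_ ?_ ?_ ?_
  · rintro ⟨j, l⟩ h
    simp only [Finset.mem_sigma, Finset.mem_compl, Finset.mem_insert, not_or] at h
    obtain ⟨hj, hlj, hl⟩ := h
    have key : ∀ p q : Fin n, p ∉ G → ((insert p G).filter (· < q)).card =
        (G.filter (· < q)).card + if p < q then 1 else 0 := by
      intro p q hp
      rw [Finset.filter_insert]
      split_ifs
      · rw [Finset.card_insert_of_notMem (by simp [hp])]
      · rfl
    simp only [key j l hj, key l j hl, Finset.insert_comm l j G]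
    rcases lt_or_gt_of_ne hlj with h | h
    · simp only [h, h.not_gt, if_true, if_false, pow_add]
      ring
    · simp only [h, h.not_gt, if_true, if_false, pow_add]
      ring
  · rintro ⟨j, l⟩ h _ he
    simp only [Finset.mem_sigma, Finset.mem_compl, Finset.mem_insert, not_or] at h
    simp only [Sigma.mk.injEq] at he
    exact h.2.1 he.1
  · rintro ⟨j, l⟩ h
    simp only [Finset.mem_sigma, Finset.mem_compl, Finset.mem_insert, not_or] at h ⊢
    exact ⟨h.2.2, fun h' => h.2.1 h'.symm, h.1⟩
  · rintro ⟨j, l⟩ _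
    rfl

/-- The part of homological degree `i` and multidegree `a` of the Koszul complex with coefficients
in the ideal `I`: the sums `∑ F, f F • e_F` over the `F` with `i` elements, where `f F ∈ I` is a
scalar multiple of the monomial `x^b` with `b + ∑ j ∈ F, e_j = a` (and is `0` if there is no
such `b`). -/
noncomputable def koszulChains (I : Ideal (MvPolynomial (Fin n) K)) (i : ℕ) (a : Fin n →₀ ℕ) :
    Submodule K (Finset (Fin n) → MvPolynomial (Fin n) K) where
  carrier := {f | ∀ F, f F ∈ I ∧ ∀ b, coeff b (f F) ≠ 0 →
    F.card = i ∧ b + ∑ j ∈ F, Finsupp.single j 1 = a}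
  zero_mem' := fun F => ⟨by simp, fun b hb => by simp at hb⟩
  add_mem' := by
    intro f g hf hg F
    refine ⟨I.add_mem (hf F).1 (hg F).1, fun b hb => ?_⟩
    by_cases h : coeff b (f F) = 0
    · refine (hg F).2 b fun h' => hb ?_
      simp [h, h']
    · exact (hf F).2 b h
  smul_mem' := by
    intro c f hf F
    refine ⟨?_, fun b hb => (hf F).2 b fun h => hb ?_⟩
    · rw [Pi.smul_apply, smul_eq_C_mul]
      exact I.mul_mem_left _ (hf F).1
    · simp [h]

/-- The cycles of homological degree `i` and multidegree `a`. -/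
noncomputable def koszulCycles (I : Ideal (MvPolynomial (Fin n) K)) (i : ℕ) (a : Fin n →₀ ℕ) :
    Submodule K (Finset (Fin n) → MvPolynomial (Fin n) K) :=
  koszulChains I i a ⊓ LinearMap.ker ((koszulD K n).restrictScalars K)

/-- The boundaries of homological degree `i` and multidegree `a`: the images under the differential
of the chains of homological degree `i + 1` and multidegree `a`. -/
noncomputable def koszulBoundaries (I : Ideal (MvPolynomial (Fin n) K)) (i : ℕ)
    (a : Fin n →₀ ℕ) : Submodule K (Finset (Fin n) → MvPolynomial (Fin n) K) :=
  (koszulChains I (i + 1) a).map ((koszulD K n).restrictScalars K)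

theorem koszulBoundaries_le_koszulCycles (I : Ideal (MvPolynomial (Fin n) K)) (i : ℕ)
    (a : Fin n →₀ ℕ) : koszulBoundaries I i a ≤ koszulCycles I i a := by
  rintro _ ⟨f, hf, rfl⟩
  refine ⟨fun G => ⟨?_, fun b hb => ?_⟩, koszulD_koszulD f⟩
  · rw [LinearMap.restrictScalars_apply, koszulD_apply]
    exact I.sum_mem fun j _ => I.mul_mem_left _ (hf _).1
  · rw [LinearMap.restrictScalars_apply, koszulD_apply, coeff_sum] at hb
    obtain ⟨j, hj, hb⟩ := Finset.exists_ne_zero_of_sum_ne_zero hb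
    have hjG : j ∉ G := by simpa using hj
    have hs : (-1 : MvPolynomial (Fin n) K) ^ (G.filter (· < j)).card =
        C ((-1) ^ (G.filter (· < j)).card) := by simp
    rw [hs, mul_assoc, coeff_C_mul, coeff_X_mul'] at hb
    split_ifs at hb with hjb
    · obtain ⟨h1, h2⟩ := (hf (insert j G)).2 _ (right_ne_zero_of_mul hb)
      rw [Finset.card_insert_of_notMem hjG] at h1
      rw [Finset.sum_insert hjG, ← add_assoc, tsub_add_cancel_of_le] at h2
      · exact ⟨by omega, h2⟩
      · rw [Finsupp.single_le_iff]
        exact Nat.one_le_iff_ne_zero.mpr (Finsupp.mem_support_iff.mp hjb)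
    · simp at hb

/-- The `K`-vector space `Tor_i^S(K, I)_a`, cycles modulo boundaries. -/
abbrev MultigradedTor (I : Ideal (MvPolynomial (Fin n) K)) (i : ℕ) (a : Fin n →₀ ℕ) : Type _ :=
  koszulCycles I i a ⧸ (koszulBoundaries I i a).submoduleOf (koszulCycles I i a)

/-- The `i`-th homological shift ideal `HS_i(I) = (x^a : Tor_i^S(K, I)_a ≠ 0)`. -/
noncomputable def homologicalShift (i : ℕ) (I : Ideal (MvPolynomial (Fin n) K)) :
    Ideal (MvPolynomial (Fin n) K) :=
  Ideal.span {m | ∃ a : Fin n →₀ ℕ, Nontrivial (MultigradedTor I i a) ∧ m = monomial a 1}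

end Koszul

end HomShift

/-! The argument reduces everything to exponent vectors. If all vectors of `B` have one degree and
satisfy the exchange property, then `HS_1` of the ideal generated by `B` is generated by the
monomials divisible by two distinct generators (`IsBaseSet.homologicalShift_one`). Above a single
generator a Koszul contraction kills the homology; above two, an exchange produces a linear syzygy.

Powers of `I` correspond to sums of bases, which again have the exchange property (`IsBaseSet.add`).
So it must be shown that `c` dominates two elements of the `k`-fold sum if `c + b` dominates two
elements of the `(k+1)`-fold sum for every `b ∈ B` (`IsBaseSet.mem_doublyDominating_kfold_iff`).
Separation by coordinate sums gives one dominated `u`, which amounts to `I^(k+1) : I = I^k`. Were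
`u` the only one, it would be maximal in every coordinate where `c` has slack, and adding a summand
`b` of `u` would leave `c + b` above `b + u` alone.

The chain of associated primes follows because `Ass (R/(J : I)) ⊆ Ass (R/J)` in a Noetherian ring.
-/

namespace HomShift

/-! ### Exchange properties and separation for base sets -/

section BaseSets

variable {n : ℕ}

/-- The sum of the positive parts of the coordinates of `u - v`. -/
def excess (u v : Fin n →₀ ℕ) : ℕ := ∑ i, (u i - v i)

theorem apply_add_ite {u w : Fin n →₀ ℕ} {i j : Fin n}
    (h : w + Finsupp.single i 1 = u + Finsupp.single j 1) (l : Fin n) :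
    w l + (if i = l then 1 else 0) = u l + (if j = l then 1 else 0) := by
  simpa [Finsupp.single_apply] using DFunLike.congr_fun h l

/-- An exchange towards `v` brings `u` closer to `v`; this decrease drives the inductions below. -/
theorem excess_lt {u w v : Fin n →₀ ℕ} {i j : Fin n} (hi : v i < u i) (hj : u j < v j)
    (h : w + Finsupp.single i 1 = u + Finsupp.single j 1) : excess w v < excess u v := by
  have hij : j ≠ i := by rintro rfl; omega
  refine Finset.sum_lt_sum (fun l _ => ?_) ⟨i, Finset.mem_univ _, ?_⟩
  · have := apply_add_ite h l
    by_cases hl : j = l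
    · subst hl
      simp only [hij.symm, if_true, if_false] at this
      omega
    · rw [if_neg hl] at this
      split_ifs at this <;> omega
  · have := apply_add_ite h i
    rw [if_neg hij, if_pos rfl] at this
    omega

/-- A set of vectors which satisfies the exchange property of the bases of a discrete
polymatroid of rank `d`. -/
structure IsBaseSet (B : Set (Fin n →₀ ℕ)) (d : ℕ) : Prop where
  nonempty : B.Nonempty
  degree_eq : ∀ u ∈ B, u.degree = d
  exchange : ∀ u ∈ B, ∀ v ∈ B, ∀ i, v i < u i →
    ∃ j, u j < v j ∧ ∃ w ∈ B, w + Finsupp.single i 1 = u + Finsupp.single j 1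

theorem IsDiscretePolymatroid.degree_le {P : Set (Fin n →₀ ℕ)} (hP : IsDiscretePolymatroid P)
    {u v : Fin n →₀ ℕ} (hu : u ∈ polymatroidBases P) (hv : v ∈ P) : v.degree ≤ u.degree := by
  by_contra! h
  obtain ⟨i, -, hi⟩ := hP.augmentation u hu.1 v hv h
  have := hu.2 hi le_self_add i
  simp at this

theorem IsDiscretePolymatroid.isBaseSet {P : Set (Fin n →₀ ℕ)} (hP : IsDiscretePolymatroid P) :
    ∃ d, IsBaseSet (polymatroidBases P) d := by
  obtain ⟨u₀, hu₀⟩ := hP.finite.exists_maximal hP.nonempty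
  have hdeg : ∀ u ∈ polymatroidBases P, u.degree = u₀.degree := fun u hu =>
    le_antisymm (hP.degree_le hu₀ hu.1) (hP.degree_le hu hu₀.1)
  refine ⟨u₀.degree, ⟨u₀, hu₀⟩, hdeg, fun u hu v hv i hi => ?_⟩
  have hle : Finsupp.single i 1 ≤ u := Finsupp.single_le_iff.mpr (by omega)
  have heq : u - Finsupp.single i 1 + Finsupp.single i 1 = u := tsub_add_cancel_of_le hle
  have hd := congrArg Finsupp.degree heq
  rw [map_add, Finsupp.degree_single] at hd
  obtain ⟨j, hj, hjP⟩ := hP.augmentation (u - Finsupp.single i 1)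
    (hP.mem_of_le u hu.1 _ tsub_le_self) v hv.1 (by rw [hdeg v hv, ← hdeg u hu]; omega)
  -- After one unit is removed, coordinate `i` is still at least `v i`, so augmentation cannot give
  -- it back.
  have hji : i ≠ j := by
    rintro rfl
    simp at hj
    omega
  rw [Finsupp.tsub_apply, Finsupp.single_apply, if_neg hji] at hj
  refine ⟨j, hj, u - Finsupp.single i 1 + Finsupp.single j 1, ⟨hjP, fun x hx hle' => ?_⟩, ?_⟩
  · have h1 := hP.degree_le hu hx
    obtain ⟨y, rfl⟩ := exists_add_of_le hle'
    rw [map_add, map_add, Finsupp.degree_single] at h1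
    have hy : y = 0 := (Finsupp.degree_eq_zero_iff y).mp (by omega)
    simp [hy]
  · rw [add_right_comm, heq]

namespace IsBaseSet

variable {B C : Set (Fin n →₀ ℕ)} {d e : ℕ}

theorem eq_of_le (hB : IsBaseSet B d) {u v : Fin n →₀ ℕ} (hu : u ∈ B) (hv : v ∈ B)
    (h : u ≤ v) : u = v := by
  obtain ⟨y, rfl⟩ := exists_add_of_le h
  have h1 := hB.degree_eq _ hv
  rw [map_add, hB.degree_eq _ hu] at h1
  simp [(Finsupp.degree_eq_zero_iff y).mp (by omega)]

theorem zero : IsBaseSet ({0} : Set (Fin n →₀ ℕ)) 0 :=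
  ⟨⟨0, rfl⟩, by simp, by rintro u rfl v rfl i h; simp at h⟩

/-- The vector `x + y` is `u` with `i` traded for a coordinate `t` that is still too large compared
with `v`. One summand is too large at `t` and is exchanged towards its target `x'` or `y'`, which
moves the surplus to a new `j`. Either `j` is the index sought or it takes the role of `t`; the
total excess drops, so the process stops. It starts at `t = i`. -/
theorem exchange_add_aux (hB : IsBaseSet B d) (hC : IsBaseSet C e) {u v x' y' : Fin n →₀ ℕ}
    (hx' : x' ∈ B) (hy' : y' ∈ C) (hv : v = x' + y') {i : Fin n} (hi : v i < u i) :
    ∀ (N : ℕ) (x y : Fin n →₀ ℕ) (t : Fin n), excess x x' + excess y y' = N → x ∈ B → y ∈ C →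
      x + y + Finsupp.single i 1 = u + Finsupp.single t 1 → v t < (x + y) t →
      ∃ j, u j < v j ∧ ∃ w ∈ Set.image2 (· + ·) B C,
        w + Finsupp.single i 1 = u + Finsupp.single j 1 := by
  intro N
  induction N using Nat.strong_induction_on with
  | _ N ih =>
  intro x y t hN hx hy hxy ht
  have key : ∀ x₁ ∈ B, ∀ y₁ ∈ C, ∀ j, x₁ + y₁ + Finsupp.single t 1 = x + y + Finsupp.single j 1 →
      excess x₁ x' + excess y₁ y' < N →
      ∃ j, u j < v j ∧ ∃ w ∈ Set.image2 (· + ·) B C,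
        w + Finsupp.single i 1 = u + Finsupp.single j 1 := by
    intro x₁ hx₁ y₁ hy₁ j h hlt
    have h' : x₁ + y₁ + Finsupp.single i 1 = u + Finsupp.single j 1 := by
      have h1 : x₁ + y₁ + Finsupp.single t 1 + Finsupp.single i 1 =
          u + Finsupp.single j 1 + Finsupp.single t 1 := by
        rw [h, add_right_comm, hxy, add_right_comm]
      rw [add_right_comm] at h1
      exact add_right_cancel h1
    by_cases hj : u j < v j
    · exact ⟨j, hj, _, ⟨x₁, hx₁, y₁, hy₁, rfl⟩, h'⟩
    · refine ih _ hlt x₁ y₁ j rfl hx₁ hy₁ h' ?_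
      have := apply_add_ite h' j
      rw [if_pos rfl] at this
      split_ifs at this with hij
      · subst hij; omega
      · omega
  rw [hv, Finsupp.add_apply, Finsupp.add_apply] at ht
  rcases lt_or_ge (x' t) (x t) with h | h
  · obtain ⟨j, hj, w, hw, hwx⟩ := hB.exchange x hx x' hx' t h
    have := excess_lt h hj hwx
    refine key w hw y hy j ?_ (by omega)
    rw [add_right_comm, hwx, add_right_comm]
  · obtain ⟨j, hj, w, hw, hwy⟩ := hC.exchange y hy y' hy' t (by omega)
    have := excess_lt (by omega) hj hwy
    refine key x hx w hw j ?_ (by omega)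
    rw [add_assoc, hwy, add_assoc]

theorem add (hB : IsBaseSet B d) (hC : IsBaseSet C e) :
    IsBaseSet (Set.image2 (· + ·) B C) (d + e) := by
  refine ⟨hB.nonempty.image2 hC.nonempty, ?_, ?_⟩
  · rintro _ ⟨x, hx, y, hy, rfl⟩
    simp [hB.degree_eq x hx, hC.degree_eq y hy]
  · rintro _ ⟨x, hx, y, hy, rfl⟩ _ ⟨x', hx', y', hy', rfl⟩ i hi
    exact exchange_add_aux hB hC hx' hy' rfl hi _ x y i rfl hx hy rfl hi

/-- If some vector of `B` exceeds `u ∈ B` at `i`, then there is one that exceeds it only at `i`,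
and by one. -/
theorem exists_eq_add_one (hB : IsBaseSet B d) {u : Fin n →₀ ℕ} (hu : u ∈ B) (i : Fin n) :
    ∀ (N : ℕ) (v : Fin n →₀ ℕ), excess v u = N → v ∈ B → u i < v i →
      ∃ w ∈ B, w i = u i + 1 ∧ ∀ l ≠ i, w l ≤ u l := by
  intro N
  induction N using Nat.strong_induction_on with
  | _ N ih =>
  intro v hN hv hi
  by_cases h : v i = u i + 1 ∧ ∀ l ≠ i, v l ≤ u l
  · exact ⟨v, hv, h⟩
  -- The coordinate `l` to be lowered is a surplus away from `i`, or `i` itself if the surplus there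
  -- is at least two; either way `u i < v i` survives the exchange.
  · obtain ⟨l, hl, hli⟩ : ∃ l, u l < v l ∧ (l = i → u i + 1 < v i) := by
      by_cases h1 : v i = u i + 1
      · push Not at h
        obtain ⟨l, h2, h3⟩ := h h1
        exact ⟨l, h3, fun h4 => absurd h4 h2⟩
      · exact ⟨i, hi, fun _ => by omega⟩
    obtain ⟨j, hj, w, hw, hwv⟩ := hB.exchange v hv u hu l hl
    refine ih _ (hN ▸ excess_lt hl hj hwv) w rfl hw ?_
    have := apply_add_ite hwv i
    split_ifs at this with h1 h2 h2
    · omega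
    · have := hli h1; omega
    · omega
    · omega

/-- The indices that can be exchanged against `i` in `u` form a set on which `u` has the smallest
possible coordinate sum. -/
theorem sum_le_sum_of_exchangeable (hB : IsBaseSet B d) {u : Fin n →₀ ℕ} (hu : u ∈ B) (i : Fin n)
    (D : Finset (Fin n))
    (hD : ∀ j, j ∈ D ↔ ∃ w ∈ B, w + Finsupp.single i 1 = u + Finsupp.single j 1) :
    ∀ (N : ℕ) (v : Fin n →₀ ℕ), excess v u = N → v ∈ B → ∑ j ∈ D, u j ≤ ∑ j ∈ D, v j := by
  intro N
  induction N using Nat.strong_induction_on with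
  | _ N ih =>
  intro v hN hv
  by_contra! hlt
  obtain ⟨j, hjD, hj⟩ := Finset.exists_lt_of_sum_lt hlt
  obtain ⟨l, hl, w₂, hw₂, h₂⟩ := hB.exchange u hu v hv j hj
  -- `D` is closed under this exchange: `w₂ = u - e_j + e_l` and `w₁ = u - e_i + e_j` lie in `B`,
  -- and `w₁` exceeds `w₂` only at `j`. Exchanging `i` in `w₂` towards `w₁` therefore gives `u - e_i
  -- + e_l`.
  have hlD : l ∈ D := by
    by_cases hli : l = i
    · exact (hD l).2 ⟨u, hu, by rw [hli]⟩
    by_cases hji : j = i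
    · exact (hD l).2 ⟨w₂, hw₂, by rw [← hji, h₂]⟩
    obtain ⟨w₁, hw₁, h₁⟩ := (hD j).1 hjD
    have a₁ := apply_add_ite h₁ i
    have a₂ := apply_add_ite h₂ i
    simp only [hli, hji, if_true, if_false] at a₁ a₂
    obtain ⟨t, ht, w₃, hw₃, h₃⟩ := hB.exchange w₂ hw₂ w₁ hw₁ i (by omega)
    have htj : j = t := by
      by_contra htj
      have b₁ := apply_add_ite h₁ t
      have b₂ := apply_add_ite h₂ t
      rw [if_neg htj] at b₁ b₂
      omega
    exact (hD l).2 ⟨w₃, hw₃, by rw [h₃, ← htj, h₂]⟩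
  -- Since `l ∈ D`, lowering `v` at `l` cannot increase its sum over `D`, whatever `t` is.
  obtain ⟨t, ht, v', hv', h'⟩ := hB.exchange v hv u hu l hl
  have h1 := ih _ (hN ▸ excess_lt hl ht h') v' rfl hv'
  have h2 := Finset.sum_congr (rfl : D = D) fun x _ => apply_add_ite h' x
  rw [Finset.sum_add_distrib, Finset.sum_add_distrib, Finset.sum_ite_eq, Finset.sum_ite_eq,
    if_pos hlD] at h2
  split_ifs at h2 <;> omega

/-- A vector which dominates no element of a base set is separated from it by a coordinate sum. -/
theorem exists_separating (hB : IsBaseSet B d) {c : Fin n →₀ ℕ} (hc : ∀ u ∈ B, ¬ u ≤ c) :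
    ∃ u ∈ B, ∃ D : Finset (Fin n), ∑ j ∈ D, c j < ∑ j ∈ D, u j ∧
      ∀ v ∈ B, ∑ j ∈ D, u j ≤ ∑ j ∈ D, v j := by
  classical
  obtain ⟨u, hu, hmin⟩ := exists_minimalFor_of_wellFoundedLT (· ∈ B) (excess · c) hB.nonempty
  obtain ⟨i, hi⟩ : ∃ i, c i < u i := by
    simpa [Finsupp.le_def] using hc u hu
  let D : Finset (Fin n) := Finset.univ.filter fun j =>
    ∃ w ∈ B, w + Finsupp.single i 1 = u + Finsupp.single j 1
  have hD : ∀ j, j ∈ D ↔ ∃ w ∈ B, w + Finsupp.single i 1 = u + Finsupp.single j 1 := by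
    simp [D]
  refine ⟨u, hu, D, Finset.sum_lt_sum (fun j hj => ?_) ⟨i, (hD i).2 ⟨u, hu, rfl⟩, hi⟩,
    fun v hv => hB.sum_le_sum_of_exchangeable hu i D hD _ v rfl hv⟩
  -- If `u j < c j`, trading `i` for `j` in `u` would lower the excess over `c`, against the choice
  -- of `u`.
  by_contra! hlt
  obtain ⟨w, hw, h⟩ := (hD j).1 hj
  have h1 : excess w c < excess u c := excess_lt hi hlt h
  exact absurd (hmin hw h1.le) (not_le.mpr h1)

end IsBaseSet

/-! ### Sums of bases and the colon at the level of exponents -/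

/-- The sums of `k` elements of `B`. -/
def kfold (B : Set (Fin n →₀ ℕ)) : ℕ → Set (Fin n →₀ ℕ)
  | 0 => {0}
  | k + 1 => Set.image2 (· + ·) B (kfold B k)

theorem IsBaseSet.kfold {B : Set (Fin n →₀ ℕ)} {d : ℕ} (hB : IsBaseSet B d) (k : ℕ) :
    ∃ e, IsBaseSet (kfold B k) e := by
  induction k with
  | zero => exact ⟨0, IsBaseSet.zero⟩
  | succ k ih => exact ⟨_, hB.add ih.choose_spec⟩

/-- The vectors that dominate at least two elements of `B`. -/
def doublyDominating (B : Set (Fin n →₀ ℕ)) : Set (Fin n →₀ ℕ) :=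
  {a | ∃ u ∈ B, ∃ v ∈ B, u ≠ v ∧ u ≤ a ∧ v ≤ a}

/-- Otherwise some coordinate sum over a set `D` is smaller at `c` than on the whole `k`-fold sum.
For `b ∈ B` with the least sum over `D`, `c + b` then has a smaller sum than every `b' + v`, so it
dominates none of them. -/
theorem IsBaseSet.exists_mem_kfold_le {B : Set (Fin n →₀ ℕ)} {d : ℕ} (hB : IsBaseSet B d) (k : ℕ)
    {c : Fin n →₀ ℕ} (hc : ∀ b ∈ B, ∃ w ∈ HomShift.kfold B (k + 1), w ≤ c + b) :
    ∃ u ∈ HomShift.kfold B k, u ≤ c := by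
  obtain ⟨e, hk⟩ := hB.kfold k
  by_contra! hcon
  obtain ⟨u, hu, D, hlt, hmin⟩ := hk.exists_separating hcon
  obtain ⟨b, hb, hbmin⟩ :=
    exists_minimalFor_of_wellFoundedLT (· ∈ B) (fun b => ∑ j ∈ D, b j) hB.nonempty
  obtain ⟨_, ⟨b', hb', v, hv, rfl⟩, hle⟩ := hc b hb
  have h1 : ∑ j ∈ D, (b' j + v j) ≤ ∑ j ∈ D, (c j + b j) :=
    Finset.sum_le_sum fun j _ => hle j
  rw [Finset.sum_add_distrib, Finset.sum_add_distrib] at h1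
  have h2 := hmin v hv
  have h3 : ∑ j ∈ D, b j ≤ ∑ j ∈ D, b' j := by
    rcases le_total (∑ j ∈ D, b j) (∑ j ∈ D, b' j) with h | h
    · exact h
    · exact hbmin hb' h
  omega

theorem IsBaseSet.mem_doublyDominating_kfold_iff {B : Set (Fin n →₀ ℕ)} {d : ℕ}
    (hB : IsBaseSet B d) {k : ℕ} (hk : 1 ≤ k) (c : Fin n →₀ ℕ) :
    (∀ b ∈ B, c + b ∈ doublyDominating (HomShift.kfold B (k + 1))) ↔
      c ∈ doublyDominating (HomShift.kfold B k) := by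
  constructor
  · intro h
    obtain ⟨e, hBk⟩ := hB.kfold k
    obtain ⟨e', hBk'⟩ := hB.kfold (k + 1)
    obtain ⟨u, hu, huc⟩ := hB.exists_mem_kfold_le k fun b hb =>
      let ⟨w, hw, _, _, _, hle, _⟩ := h b hb
      ⟨w, hw, hle⟩
    by_contra hc
    have huniq : ∀ w ∈ HomShift.kfold B k, w ≤ c → w = u := fun w hw hwc => by
      by_contra hne
      exact hc ⟨w, hw, u, hu, hne, hwc, huc⟩
    -- A larger value at `i` would yield `w` exceeding `u` only at `i`, by one; the slack of `c`
    -- there gives `w ≤ c`, against uniqueness.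
    have hmax : ∀ i, u i < c i → ∀ v ∈ HomShift.kfold B k, v i ≤ u i := by
      intro i hi v hv
      by_contra! hlt
      obtain ⟨w, hw, hwi, hwl⟩ := hBk.exists_eq_add_one hu i _ v rfl hv hlt
      have hwu := huniq w hw fun l => by
        by_cases hl : l = i
        · subst hl; omega
        · exact (hwl l hl).trans (huc l)
      rw [hwu] at hwi
      omega
    -- Here `k ≥ 1` matters: `u` has a summand `b ∈ B`, which inherits maximality in the slack
    -- coordinates.
    obtain ⟨k, rfl⟩ : ∃ m, k = m + 1 := ⟨k - 1, by omega⟩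
    obtain ⟨b, hb, y, hy, hby⟩ := id hu
    have hbmax : ∀ i, u i < c i → ∀ b' ∈ B, b' i ≤ b i := by
      intro i hi b' hb'
      have h1 := hmax i hi _ ⟨b', hb', y, hy, rfl⟩
      rw [← hby] at h1
      simpa using h1
    have hsum : ∀ w ∈ HomShift.kfold B (k + 1 + 1), w ≤ c + b → w = b + u := by
      intro w hw hwc
      refine hBk'.eq_of_le hw ⟨b, hb, u, hu, rfl⟩ fun i => ?_
      -- In slack coordinates both summands of `w` are bounded by the maxima; elsewhere `c i = u i`,
      -- so `w ≤ c + b` suffices.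
      by_cases hi : u i < c i
      · obtain ⟨b', hb', v, hv, rfl⟩ := hw
        exact add_le_add (hbmax i hi b' hb') (hmax i hi v hv)
      · have h1 := hwc i
        have h2 := huc i
        rw [Finsupp.add_apply] at h1 ⊢
        omega
    obtain ⟨w, hw, w', hw', hne, hwc, hwc'⟩ := h b hb
    exact hne ((hsum w hw hwc).trans (hsum w' hw' hwc').symm)
  · rintro ⟨u, hu, v, hv, hne, huc, hvc⟩ b hb
    refine ⟨b + u, ⟨b, hb, u, hu, rfl⟩, b + v, ⟨b, hb, v, hv, rfl⟩, by simpa using hne, ?_, ?_⟩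
    · rw [add_comm]; gcongr
    · rw [add_comm]; gcongr

end BaseSets


/-! ### Associated primes of colon ideals -/

theorem associatedPrimes_quotient_colon_subset {R : Type*} [CommRing R] [IsNoetherianRing R]
    (J I : Ideal R) :
    associatedPrimes R (R ⧸ J.colon (I : Set R)) ⊆ associatedPrimes R (R ⧸ J) := by
  intro P hP
  rw [AssociatedPrimes.mem_iff, isAssociatedPrime_iff] at hP ⊢
  obtain ⟨hPp, x, hx⟩ := hP
  obtain ⟨x, rfl⟩ := Ideal.Quotient.mk_surjective x
  obtain ⟨s, rfl⟩ := IsNoetherian.noetherian I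
  have hmem : ∀ (J' : Ideal R) (y r : R),
      r ∈ (⊥ : Submodule R (R ⧸ J')).colon {Ideal.Quotient.mk J' y} ↔ r * y ∈ J' := by
    intro J' y r
    rw [Submodule.mem_colon_singleton, Submodule.mem_bot, Algebra.smul_def,
      Ideal.Quotient.algebraMap_eq, ← map_mul, Ideal.Quotient.eq_zero_iff_mem]
  -- With `I` generated by the finite set `s`, `(J : I) : x` is the intersection of the `J : (x f)`,
  -- `f ∈ s`. A prime that is a finite intersection equals one of its members.
  have hinf : P = s.inf fun f => (⊥ : Submodule R (R ⧸ J)).colon {Ideal.Quotient.mk J (x * f)} := by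
    ext r
    rw [hx, hmem, Submodule.mem_finsetInf]
    simp only [hmem]
    rw [Submodule.colon_span, Submodule.mem_colon]
    simp only [smul_eq_mul, mul_assoc, SetLike.mem_coe]
  obtain ⟨f, -, hf⟩ := Ideal.eq_inf_of_isPrime_inf (hinf ▸ hPp)
  exact ⟨hPp, _, hinf.trans hf.symm⟩

/-! ### Products and colons of monomial ideals -/

section Ideals

variable {K : Type*} [Field K] {n : ℕ}

variable (K) in
/-- The ideal generated by the monomials with exponents in `B`. -/
noncomputable def monomialIdeal (B : Set (Fin n →₀ ℕ)) : Ideal (MvPolynomial (Fin n) K) :=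
  Ideal.span ((fun a => monomial a (1 : K)) '' B)

theorem mem_monomialIdeal {B : Set (Fin n →₀ ℕ)} {p : MvPolynomial (Fin n) K} :
    p ∈ monomialIdeal K B ↔ ∀ c ∈ p.support, ∃ b ∈ B, b ≤ c :=
  mem_ideal_span_monomial_image

theorem monomial_mem_monomialIdeal {B : Set (Fin n →₀ ℕ)} {c : Fin n →₀ ℕ} {r : K}
    (hr : r ≠ 0) : monomial c r ∈ monomialIdeal K B ↔ ∃ b ∈ B, b ≤ c := by
  simp [mem_monomialIdeal, hr]

theorem IsMonomialIdeal.eq_monomialIdeal_minimalGenerators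
    {I : Ideal (MvPolynomial (Fin n) K)} (hI : IsMonomialIdeal I) :
    I = monomialIdeal K (minimalGenerators I) := by
  obtain ⟨s, hs⟩ := hI
  refine le_antisymm ?_ (Ideal.span_le.mpr ?_)
  · conv_lhs => rw [hs]
    refine Ideal.span_le.mpr ?_
    rintro _ ⟨a, ha, rfl⟩
    refine (monomial_mem_monomialIdeal one_ne_zero).mpr ?_
    have haI : monomial a (1 : K) ∈ I := hs ▸ Ideal.subset_span ⟨a, ha, rfl⟩
    obtain ⟨b, hba, hb⟩ := exists_minimal_le_of_wellFoundedLT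
      (fun b => monomial b (1 : K) ∈ I) a haI
    exact ⟨b, hb, hba⟩
  · rintro _ ⟨a, ha, rfl⟩
    exact ha.1

theorem monomialIdeal_mul (B C : Set (Fin n →₀ ℕ)) :
    monomialIdeal K B * monomialIdeal K C = monomialIdeal K (Set.image2 (· + ·) B C) := by
  rw [monomialIdeal, monomialIdeal, Ideal.span_mul_span', monomialIdeal]
  congr 1
  ext p
  simp only [Set.mem_mul, Set.mem_image, Set.mem_image2, exists_exists_and_eq_and, monomial_mul,
    mul_one]
  constructor
  · rintro ⟨a, ha, b, hb, rfl⟩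
    exact ⟨_, ⟨a, ha, b, hb, rfl⟩, rfl⟩
  · rintro ⟨_, ⟨a, ha, b, hb, rfl⟩, rfl⟩
    exact ⟨a, ha, b, hb, rfl⟩

theorem monomialIdeal_pow (B : Set (Fin n →₀ ℕ)) (k : ℕ) :
    monomialIdeal K B ^ k = monomialIdeal K (kfold B k) := by
  induction k with
  | zero =>
    rw [pow_zero, eq_comm, Ideal.one_eq_top, Ideal.eq_top_iff_one]
    exact (monomial_mem_monomialIdeal one_ne_zero).mpr ⟨0, rfl, le_rfl⟩
  | succ k ih => rw [pow_succ', ih, monomialIdeal_mul, kfold]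

theorem mem_colon_monomialIdeal {B C : Set (Fin n →₀ ℕ)} {p : MvPolynomial (Fin n) K} :
    p ∈ (monomialIdeal K C).colon (monomialIdeal K B : Set (MvPolynomial (Fin n) K)) ↔
      ∀ c ∈ p.support, ∀ b ∈ B, ∃ a ∈ C, a ≤ c + b := by
  rw [monomialIdeal.eq_def K B, Ideal.span, Submodule.colon_span, Submodule.mem_colon,
    Set.forall_mem_image]
  simp only [smul_eq_mul]
  constructor
  · intro h c hc b hb
    refine mem_monomialIdeal.mp (h hb) _ ?_
    rw [mem_support_iff, coeff_mul_monomial, mul_one]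
    exact mem_support_iff.mp hc
  · intro h b hb
    refine mem_monomialIdeal.mpr fun c hc => ?_
    rw [mem_support_iff, coeff_mul_monomial'] at hc
    split_ifs at hc with hbc
    · obtain ⟨a, ha, hle⟩ := h (c - b) (by simpa using hc) b hb
      exact ⟨a, ha, by rwa [tsub_add_cancel_of_le hbc] at hle⟩
    · exact absurd rfl hc

end Ideals

/-! ### Koszul homology and the first homological shift ideal -/

section Koszul

variable {K : Type*} [Field K] {n : ℕ}

theorem card_filter_insert_lt {G : Finset (Fin n)} {p : Fin n} (hp : p ∉ G) (q : Fin n) :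
    ((insert p G).filter (· < q)).card = (G.filter (· < q)).card + if p < q then 1 else 0 := by
  rw [Finset.filter_insert]
  split_ifs
  · rw [Finset.card_insert_of_notMem (by simp [hp])]
  · rfl

theorem nontrivial_multigradedTor_iff (I : Ideal (MvPolynomial (Fin n) K)) (i : ℕ)
    (a : Fin n →₀ ℕ) :
    Nontrivial (MultigradedTor I i a) ↔ ∃ f ∈ koszulCycles I i a, f ∉ koszulBoundaries I i a := by
  rw [Submodule.Quotient.nontrivial_iff, ne_eq, Submodule.submoduleOf_eq_top]
  exact Set.not_subset

/-- The Koszul complex of a monomial ideal is contracted by division by `x_t` in a multidegree `a`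
such that `x_t` times every generator dividing `x^a` divides `x^a`. -/
theorem koszulCycles_le_koszulBoundaries {B : Set (Fin n →₀ ℕ)} {a : Fin n →₀ ℕ} (i : ℕ)
    {t : Fin n} (ht : ∀ u ∈ B, u ≤ a → u t < a t) :
    koszulCycles (monomialIdeal K B) i a ≤ koszulBoundaries (monomialIdeal K B) i a := by
  classical
  rintro f ⟨hf, hdf⟩
  have hdf' : koszulD K n f = 0 := hdf
  -- The contracting homotopy is `e_F ↦ e_t ∧ e_F / x_t`, zero when `t ∈ F`.
  let g : Finset (Fin n) → MvPolynomial (Fin n) K := fun F =>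
    if t ∈ F then (-1) ^ ((F.erase t).filter (· < t)).card *
      ((f (F.erase t)).divMonomial (Finsupp.single t 1)) else 0
  have hcoeff : ∀ F, t ∉ F → ∀ b, coeff b (f F) ≠ 0 → ∃ u ∈ B, u + Finsupp.single t 1 ≤ b := by
    intro F htF b hb
    obtain ⟨u, hu, hub⟩ := mem_monomialIdeal.mp (hf F).1 b (mem_support_iff.mpr hb)
    obtain ⟨-, hba⟩ := (hf F).2 b hb
    have hlt := ht u hu (hub.trans (hba ▸ le_self_add))
    -- As `t ∉ F`, the basis element `e_F` contributes nothing to coordinate `t`.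
    have hbt : a t = b t := by
      rw [← hba, Finsupp.add_apply, Finsupp.finsetSum_apply, Finset.sum_eq_zero, add_zero]
      intro j hj
      rw [Finsupp.single_apply, if_neg]
      rintro rfl
      exact htF hj
    refine ⟨u, hu, fun l => ?_⟩
    have := hub l
    rw [Finsupp.add_apply, Finsupp.single_apply]
    split_ifs with htl
    · subst htl; omega
    · omega
  have hdiv : ∀ F, t ∉ F → X t * (f F).divMonomial (Finsupp.single t 1) = f F := by
    intro F htF
    ext b
    rw [coeff_X_mul']
    split_ifs with hb
    · rw [coeff_divMonomial, add_tsub_cancel_of_le]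
      rw [Finsupp.single_le_iff]
      exact Nat.one_le_iff_ne_zero.mpr (Finsupp.mem_support_iff.mp hb)
    · by_contra hne
      obtain ⟨u, -, hu⟩ := hcoeff F htF b (Ne.symm hne)
      have := hu t
      rw [Finsupp.notMem_support_iff] at hb
      simp [hb] at this
  have hXg : ∀ F, t ∈ F →
      X t * g F = (-1) ^ ((F.erase t).filter (· < t)).card * f (F.erase t) := by
    intro F htF
    simp only [g, if_pos htF]
    rw [mul_left_comm, hdiv _ (Finset.notMem_erase t F)]
  have hg0 : ∀ F, t ∉ F → g F = 0 := fun F htF => if_neg htF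
  refine ⟨g, fun F => ?_, ?_⟩
  · by_cases htF : t ∈ F
    · have hs : (-1 : MvPolynomial (Fin n) K) ^ ((F.erase t).filter (· < t)).card =
        C ((-1) ^ ((F.erase t).filter (· < t)).card) := by simp
      have hgb : ∀ b, coeff b (g F) ≠ 0 → coeff (Finsupp.single t 1 + b) (f (F.erase t)) ≠ 0 := by
        intro b hb
        simp only [g, if_pos htF] at hb
        rw [hs, coeff_C_mul, coeff_divMonomial] at hb
        exact right_ne_zero_of_mul hb
      refine ⟨mem_monomialIdeal.mpr fun b hb => ?_, fun b hb => ?_⟩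
      · obtain ⟨u, hu, hle⟩ := hcoeff _ (Finset.notMem_erase t F) _ (hgb b (mem_support_iff.mp hb))
        rw [add_comm] at hle
        exact ⟨u, hu, le_of_add_le_add_left hle⟩
      · obtain ⟨h1, h2⟩ := (hf _).2 _ (hgb b hb)
        rw [Finset.card_erase_of_mem htF] at h1
        have := Finset.card_pos.mpr ⟨t, htF⟩
        refine ⟨by omega, ?_⟩
        rw [← h2, ← Finset.add_sum_erase F _ htF, add_comm (Finsupp.single t 1) b, add_assoc]
    · rw [hg0 F htF]
      exact ⟨zero_mem _, fun b hb => absurd (coeff_zero b) hb⟩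
  · rw [LinearMap.restrictScalars_apply]
    ext1 G
    rw [koszulD_apply]
    -- Multiplication by `x_t` undoes the division in `g`. For `t ∈ G` the cycle condition at `G ∖
    -- t` gives the identity; for `t ∉ G` only the term `j = t` survives.
    refine mul_left_cancel₀ (X_ne_zero t) ?_
    rw [Finset.mul_sum]
    by_cases htG : t ∈ G
    · have hG : insert t (G.erase t) = G := Finset.insert_erase htG
      have h0 := congrFun hdf' (G.erase t)
      rw [koszulD_apply, Finset.compl_erase, Finset.sum_insert (by simpa using htG), hG,
        Pi.zero_apply] at h0
      have hsq : ((-1 : MvPolynomial (Fin n) K) ^ ((G.erase t).filter (· < t)).card) *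
          (-1) ^ ((G.erase t).filter (· < t)).card = 1 := by
        rw [← mul_pow]; simp
      have h1 : X t * f G = - ((-1) ^ ((G.erase t).filter (· < t)).card *
          ∑ j ∈ Gᶜ, (-1) ^ ((G.erase t).filter (· < j)).card * X j *
            f (insert j (G.erase t))) := by
        linear_combination (-1 : MvPolynomial (Fin n) K) ^ ((G.erase t).filter (· < t)).card * h0 -
          X t * f G * hsq
      rw [h1, Finset.mul_sum, ← Finset.sum_neg_distrib]
      refine Finset.sum_congr rfl fun j hj => ?_
      have hjG : j ∉ G := by simpa using hj
      have hjt : j ≠ t := by rintro rfl; exact hjG htG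
      rw [mul_left_comm, hXg _ (Finset.mem_insert_of_mem htG), Finset.erase_insert_of_ne hjt,
        card_filter_insert_lt (fun h => hjG (Finset.mem_of_mem_erase h))]
      have hc := card_filter_insert_lt (Finset.notMem_erase t G) j
      rw [hG] at hc
      rw [hc]
      rcases lt_or_gt_of_ne hjt with h | h
      · simp only [h, h.not_gt, if_true, if_false, pow_add]
        ring
      · simp only [h, h.not_gt, if_true, if_false, pow_add]
        ring
    · rw [Finset.sum_eq_single t]
      · rw [mul_left_comm, hXg _ (Finset.mem_insert_self t G), Finset.erase_insert htG]
        have hsq : ((-1 : MvPolynomial (Fin n) K) ^ (G.filter (· < t)).card) *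
            (-1) ^ (G.filter (· < t)).card = 1 := by
          rw [← mul_pow]; simp
        linear_combination X t * f G * hsq
      · intro j hj hjt
        rw [hg0 _ (by simp [htG, hjt.symm]), mul_zero, mul_zero]
      · intro h
        exact absurd (Finset.mem_compl.mpr htG) h

/-- A nonzero coefficient of a cycle at `e_t` sits at `x^b` with `b + e_t = a`, so a generator `u ≤
b` satisfies `u t < a t`. If `u` were the only generator below `a`, the contraction along `t` would
make the cycle a boundary. -/
theorem mem_doublyDominating_of_nontrivial {B : Set (Fin n →₀ ℕ)} {a : Fin n →₀ ℕ}
    (h : Nontrivial (MultigradedTor (monomialIdeal K B) 1 a)) : a ∈ doublyDominating B := by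
  obtain ⟨f, hf, hfb⟩ := (nontrivial_multigradedTor_iff _ _ _).mp h
  have hne : f ≠ 0 := by
    rintro rfl
    exact hfb (zero_mem _)
  obtain ⟨F, hF⟩ := Function.ne_iff.mp hne
  obtain ⟨b, hb⟩ := exists_coeff_ne_zero hF
  obtain ⟨hcard, hba⟩ := (hf.1 F).2 b hb
  obtain ⟨t, rfl⟩ := Finset.card_eq_one.mp hcard
  obtain ⟨u, hu, hub⟩ := mem_monomialIdeal.mp (hf.1 {t}).1 b (mem_support_iff.mpr hb)
  rw [Finset.sum_singleton] at hba
  have hua : u ≤ a := hub.trans (hba ▸ le_self_add)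
  by_contra hcon
  refine hfb (koszulCycles_le_koszulBoundaries 1 (t := t) (fun v hv hva => ?_) hf)
  have hvu : v = u := by
    by_contra hvu
    exact hcon ⟨v, hv, u, hu, hvu, hva, hua⟩
  have := hub t
  rw [hvu, ← hba]
  simp
  omega

/-- The linear syzygy `x^u e_j - x^v e_i` is a cycle. It is no boundary, since a 2-chain of this
multidegree would have coefficients of degree `d - 1`, while the ideal starts in degree `d`. -/
theorem IsBaseSet.nontrivial_multigradedTor {B : Set (Fin n →₀ ℕ)} {d : ℕ} (hB : IsBaseSet B d)
    {u v : Fin n →₀ ℕ} (hu : u ∈ B) (hv : v ∈ B) {i j : Fin n} (hij : i ≠ j)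
    (h : v + Finsupp.single i 1 = u + Finsupp.single j 1) :
    Nontrivial (MultigradedTor (monomialIdeal K B) 1 (u + Finsupp.single j 1)) := by
  classical
  rw [nontrivial_multigradedTor_iff]
  let f : Finset (Fin n) → MvPolynomial (Fin n) K :=
    Pi.single (M := fun _ => MvPolynomial (Fin n) K) {j} (monomial u 1) -
      Pi.single (M := fun _ => MvPolynomial (Fin n) K) {i} (monomial v 1)
  have hchain : ∀ w ∈ B, ∀ l, w + Finsupp.single l 1 = u + Finsupp.single j 1 →
      (Pi.single {l} (monomial w 1) : Finset (Fin n) → MvPolynomial (Fin n) K) ∈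
        koszulChains (monomialIdeal K B) 1 (u + Finsupp.single j 1) := by
    intro w hw l hl F
    by_cases hF : F = {l}
    · subst hF
      rw [Pi.single_eq_same]
      refine ⟨(monomial_mem_monomialIdeal one_ne_zero).mpr ⟨w, hw, le_rfl⟩, fun b hb => ?_⟩
      rw [coeff_monomial] at hb
      split_ifs at hb with hwb
      · exact ⟨Finset.card_singleton l, by rw [Finset.sum_singleton, ← hwb, hl]⟩
      · exact absurd rfl hb
    · rw [Pi.single_eq_of_ne hF]
      exact ⟨zero_mem _, fun b hb => absurd (coeff_zero b) hb⟩
  have hD : ∀ w l, koszulD K n (Pi.single {l} (monomial w 1)) =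
      Pi.single (M := fun _ : Finset (Fin n) => MvPolynomial (Fin n) K) ∅
        (monomial (w + Finsupp.single l 1) 1) := by
    intro w l
    ext1 G
    rw [koszulD_apply]
    by_cases hG : G = ∅
    · subst hG
      rw [Pi.single_eq_same, Finset.sum_eq_single l]
      · simp [X, monomial_mul, add_comm]
      · intro m _ hm
        rw [Pi.single_eq_of_ne (by simpa using hm), mul_zero]
      · simp
    · rw [Pi.single_eq_of_ne hG]
      refine Finset.sum_eq_zero fun m hm => ?_
      rw [Pi.single_eq_of_ne, mul_zero]
      intro he
      have := congrArg Finset.card he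
      rw [Finset.card_insert_of_notMem (by simpa using hm), Finset.card_singleton] at this
      exact hG (Finset.card_eq_zero.mp (by omega))
  refine ⟨f, ⟨Submodule.sub_mem _ (hchain u hu j rfl) (hchain v hv i h), ?_⟩, ?_⟩
  · change koszulD K n f = 0
    rw [map_sub, hD, hD, h, sub_self]
  · rintro ⟨g, hg, hgf⟩
    have hg0 : g = 0 := by
      ext1 F
      by_contra hne
      obtain ⟨b, hb⟩ := exists_coeff_ne_zero hne
      obtain ⟨hcard, hba⟩ := (hg F).2 b hb
      obtain ⟨w, hw, hwb⟩ := mem_monomialIdeal.mp (hg F).1 b (mem_support_iff.mpr hb)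
      have h1 := congrArg Finsupp.degree hba
      simp only [map_add, map_sum, Finsupp.degree_single, Finset.sum_const, hcard,
        hB.degree_eq u hu, smul_eq_mul] at h1
      have h2 := Finsupp.degree_mono hwb
      rw [hB.degree_eq w hw] at h2
      omega
    rw [hg0, map_zero] at hgf
    have h1 := congrFun hgf {j}
    simp only [f, Pi.zero_apply, Pi.sub_apply, Pi.single_eq_same] at h1
    rw [Pi.single_eq_of_ne (by simpa using hij.symm), sub_zero, eq_comm, monomial_eq_zero] at h1
    exact one_ne_zero h1

theorem IsBaseSet.homologicalShift_one {B : Set (Fin n →₀ ℕ)} {d : ℕ} (hB : IsBaseSet B d) :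
    homologicalShift 1 (monomialIdeal K B) = monomialIdeal K (doublyDominating B) := by
  refine le_antisymm (Ideal.span_le.mpr ?_) (Ideal.span_le.mpr ?_)
  · rintro _ ⟨a, ha, rfl⟩
    exact Ideal.subset_span ⟨a, mem_doublyDominating_of_nontrivial ha, rfl⟩
  · rintro _ ⟨a, ⟨u, hu, v, hv, hne, hua, hva⟩, rfl⟩
    obtain ⟨i, hi⟩ : ∃ i, v i < u i := by
      by_contra! hle
      exact hne (hB.eq_of_le hu hv hle)
    obtain ⟨j, hj, w, hw, h⟩ := hB.exchange u hu v hv i hi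
    have hij : i ≠ j := by rintro rfl; omega
    -- At `j` there is room for one more, because `u j < v j ≤ a j`.
    have hle : u + Finsupp.single j 1 ≤ a := fun l => by
      have h1 := hua l
      have h2 := hva l
      rw [Finsupp.add_apply, Finsupp.single_apply]
      split_ifs with hl
      · subst hl; omega
      · omega
    refine Ideal.mem_of_dvd _ (monomial_one_dvd_monomial_one.mpr hle) (Ideal.subset_span ?_)
    exact ⟨_, hB.nontrivial_multigradedTor hu hw hij h, rfl⟩

theorem IsBaseSet.colon_homologicalShift_one {B : Set (Fin n →₀ ℕ)} {d : ℕ} (hB : IsBaseSet B d)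
    {k : ℕ} (hk : 1 ≤ k) :
    (homologicalShift 1 (monomialIdeal K B ^ (k + 1))).colon
        (monomialIdeal K B : Set (MvPolynomial (Fin n) K)) =
      homologicalShift 1 (monomialIdeal K B ^ k) := by
  have hup : ∀ (C : Set (Fin n →₀ ℕ)) (c : Fin n →₀ ℕ),
      (∃ a ∈ doublyDominating C, a ≤ c) ↔ c ∈ doublyDominating C := fun C c =>
    ⟨fun ⟨_, ⟨u, hu, v, hv, hne, hua, hva⟩, hac⟩ =>
      ⟨u, hu, v, hv, hne, hua.trans hac, hva.trans hac⟩, fun h => ⟨c, h, le_rfl⟩⟩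
  obtain ⟨e, hBk⟩ := hB.kfold k
  obtain ⟨e', hBk'⟩ := hB.kfold (k + 1)
  rw [monomialIdeal_pow, monomialIdeal_pow, hBk.homologicalShift_one, hBk'.homologicalShift_one]
  ext p
  rw [mem_colon_monomialIdeal, mem_monomialIdeal]
  simp only [hup, hB.mem_doublyDominating_kfold_iff hk]

end Koszul

end HomShift

theorem mainTheorem4 {K : Type*} [Field K] {n : ℕ} (I : Ideal (MvPolynomial (Fin n) K))
    (hI : HomShift.IsPolymatroidal I) :
    (∀ k : ℕ, 1 ≤ k →
      (HomShift.homologicalShift 1 (I ^ (k + 1))).colon (I : Set (MvPolynomial (Fin n) K)) =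
        HomShift.homologicalShift 1 (I ^ k)) ∧
    (∀ k : ℕ, 1 ≤ k →
      associatedPrimes (MvPolynomial (Fin n) K)
          (MvPolynomial (Fin n) K ⧸ HomShift.homologicalShift 1 (I ^ k)) ⊆
        associatedPrimes (MvPolynomial (Fin n) K)
          (MvPolynomial (Fin n) K ⧸ HomShift.homologicalShift 1 (I ^ (k + 1)))) := by
  obtain ⟨hmon, P, hP, hgen⟩ := hI
  obtain ⟨d, hB⟩ := hP.isBaseSet
  have hcolon : ∀ k : ℕ, 1 ≤ k →
      (HomShift.homologicalShift 1 (I ^ (k + 1))).colon (I : Set (MvPolynomial (Fin n) K)) =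
        HomShift.homologicalShift 1 (I ^ k) := by
    intro k hk
    rw [hmon.eq_monomialIdeal_minimalGenerators, hgen]
    exact hB.colon_homologicalShift_one hk
  refine ⟨hcolon, fun k hk => ?_⟩
  rw [← hcolon k hk]
  exact HomShift.associatedPrimes_quotient_colon_subset _ _
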